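/- Let $d\in\mathbb N^+$, let $\Omega\subset\mathbb R^d$ be a bounded open set (for instance a bounded Lipschitz, locally star-shaped domain), let $a>0$ and $b\in\mathbb R\setminus\{0\}$. Let $\Delta$ be the Dirichlet Laplacian on $L^2(\Omega;\mathbb R)$, i.e. its domain is $\{u\in H^1_0(\Omega):\Delta u\in L^2(\Omega)\}$ with $\Delta u$ taken in the sense of distributions, and let $\{e^{\mathcal A t}\}_{t\ge 0}$ be the strongly continuous semigroup on $L^2(\Omega;\mathbb R^2)$ generated by $$\mathcal A(z_1,z_2)^\top=(a\Delta z_1-b\Delta z_2,\; b\Delta z_1+a\Delta z_2)^\top ,$$ whose domain consists of the $(z_1,z_2)^\top$ with both components in the domain of $\Delta$. Let $\lambda_1\le\lambda_2\le\cdots\to+\infty$ be the eigenvalues of $-\Delta$, counted with multiplicity, let $\{e_i\}_{i\ge1}$ be corresponding eigenfunctions that form an orthonormal basis of $L^2(\Omega;\mathbb R)$, and for $\lambda>\lambda_1$ put $k_\lambda:=\max\{i\ge 1:\lambda_i\le\lambda\}$. For $\omega\subset\Omega$ let $\chi_\omega$ denote its characteristic function. Let $D>0$. Then there is a constant $M>0$,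 depending only on $\Omega,a,b,D$, with the following property. Let $T>0$, let $E\subset(0,T)$ be a (Lebesgue) measurable set of positive measure, and let $\{\mathcal D_t\}_{t\in(0,T)}$ be a family of subsets of $\Omega$ such that (a) for a.e. $t\in(0,T)$, $\mathcal D_t$ is measurable; (b) for every $f\in L^1(\Omega\times(0,T))$, the function $t\mapsto\int_\Omega\chi_{\mathcal D_t}(x)|f(x,t)|\,dx$ is integrable over $(0,T)$; (c) for a.e. $t\in E$, $$\sum_{i=1}^{k_\lambda}|a_i|^2\le D e^{D\sqrt\lambda}\Big(\Big\|\chi_{\mathcal D_t}\sum_{i=1}^{k_\lambda}a_ie_i\Big\|_{L^1(\Omega;\mathbb R)}\Big)^2\quad\text{for all }\lambda>\lambda_1\text{ and all }\{a_i\}_{i=1}^{k_\lambda}\subset\mathbb R .$$ Then for each $\theta\in(0,1)$ and for a.e. $t\in E$, the following inequality holds for all $z\in L^2(\Omega;\mathbb R^2)$: $$\|e^{\mathcal A t}z\|_{L^2(\Omega;\mathbb R^2)}\le M e^{M\left(\frac{t}{1-\theta}+\frac1{\theta t}\right)}\Big(\|\chi_{\mathcal D_t}e^{\mathcal A t}z\|_{L^1(\Omega;\mathbb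 R^2)}\Big)^{1-\theta}\|z\|_{L^2(\Omega;\mathbb R^2)}^{\theta}.$$ -/

import Mathlib

open MeasureTheory Filter Topology Set TopologicalSpace
open scoped Distributions

namespace CoupledHeat

/-- `L²(Ω; F)` for an open set `Ω ⊆ ℝ^d`, with respect to Lebesgue measure. -/
noncomputable abbrev L2 {d : ℕ} (Ω : Opens (EuclideanSpace ℝ (Fin d)))
    (F : Type) [NormedAddCommGroup F] :=
  Lp F 2 (volume.restrict (Ω : Set (EuclideanSpace ℝ (Fin d))))

/-- The state space `L²(Ω; ℝ²)`, where `ℝ²` carries the Euclidean norm. -/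
noncomputable abbrev State {d : ℕ} (Ω : Opens (EuclideanSpace ℝ (Fin d))) :=
  L2 Ω (EuclideanSpace ℝ (Fin 2))

/-- The `i`-th component of a state `z ∈ L²(Ω; ℝ²)`. -/
noncomputable def component {d : ℕ} {Ω : Opens (EuclideanSpace ℝ (Fin d))}
    (i : Fin 2) (z : State Ω) : L2 Ω ℝ :=
  (EuclideanSpace.proj i : EuclideanSpace ℝ (Fin 2) →L[ℝ] ℝ).compLp z

/-- `u` belongs to `H¹₀(Ω)`, the closure of `C_c^∞(Ω)` in `H¹(Ω)`, and its gradient is `g`: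
some sequence of test functions converges to `u` in `L²` while its gradients converge to `g`
in `L²`. -/
def HasH10Gradient {d : ℕ} {Ω : Opens (EuclideanSpace ℝ (Fin d))}
    (u : L2 Ω ℝ) (g : L2 Ω (EuclideanSpace ℝ (Fin d))) : Prop :=
  ∃ φ : ℕ → 𝓓(Ω, ℝ),
    Tendsto (fun n => eLpNorm (fun x => φ n x - u x) 2
      (volume.restrict (Ω : Set (EuclideanSpace ℝ (Fin d))))) atTop (𝓝 0) ∧
    Tendsto (fun n => eLpNorm (fun x => gradient (φ n) x - g x) 2
      (volume.restrict (Ω : Set (EuclideanSpace ℝ (Fin d))))) atTop (𝓝 0)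

/-- The graph of the Dirichlet Laplacian on `L²(Ω)`: `u ∈ H¹₀(Ω)` and the weak (distributional)
Laplacian of `u` is `f ∈ L²(Ω)`, that is, `∫_Ω ∇u · ∇φ = - ∫_Ω f φ` for every test function. -/
def IsDirichletLaplacian {d : ℕ} {Ω : Opens (EuclideanSpace ℝ (Fin d))}
    (u f : L2 Ω ℝ) : Prop :=
  ∃ g : L2 Ω (EuclideanSpace ℝ (Fin d)), HasH10Gradient u g ∧
    ∀ φ : 𝓓(Ω, ℝ),
      ∫ x in (Ω : Set (EuclideanSpace ℝ (Fin d))), inner ℝ (g x) (gradient φ x) =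
        -∫ x in (Ω : Set (EuclideanSpace ℝ (Fin d))), f x * φ x

/-- `lam` and `e` are the eigenvalues of `-Δ` with homogeneous Dirichlet condition, listed with
multiplicity in nondecreasing order and tending to infinity, and corresponding eigenfunctions
forming an orthonormal (Hilbert) basis of `L²(Ω; ℝ)`. Indices start at `0` here, so that
`lam i`, `e i` stand for the usual `λ_{i+1}`, `e_{i+1}`. -/
structure IsDirichletEigenbasis {d : ℕ} {Ω : Opens (EuclideanSpace ℝ (Fin d))}
    (lam : ℕ → ℝ) (e : HilbertBasis ℕ ℝ (L2 Ω ℝ)) : Prop where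
  eigen : ∀ i, IsDirichletLaplacian (e i) (-(lam i) • e i)
  mono : Monotone lam
  tendsto : Tendsto lam atTop atTop

/-- `k_μ = max {k ≥ 1 : λ_k ≤ μ}` (where `λ_k` is `lam (k - 1)`). -/
noncomputable def countUpTo (lam : ℕ → ℝ) (μ : ℝ) : ℕ :=
  sSup {k : ℕ | ∃ i, k = i + 1 ∧ lam i ≤ μ}

/-- The graph of the operator `𝒜 (z₁, z₂) = (a Δ z₁ - b Δ z₂, b Δ z₁ + a Δ z₂)` on `L²(Ω; ℝ²)`,
whose domain consists of the states with both components in the domain of the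
Dirichlet Laplacian. -/
def IsSystemOperator {d : ℕ} {Ω : Opens (EuclideanSpace ℝ (Fin d))} (a b : ℝ)
    (z w : State Ω) : Prop :=
  ∃ f₁ f₂ : L2 Ω ℝ,
    IsDirichletLaplacian (component 0 z) f₁ ∧ IsDirichletLaplacian (component 1 z) f₂ ∧
    component 0 w = a • f₁ - b • f₂ ∧ component 1 w = b • f₁ + a • f₂

/-- `(S t)_{t ≥ 0}` is the strongly continuous semigroup of bounded operators on `X` whose
infinitesimal generator is the operator with graph `G`. Values `S t` at `t < 0` play no role. -/
structure IsSemigroupGeneratedBy {X : Type*} [NormedAddCommGroup X] [NormedSpace ℝ X]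
    (G : X → X → Prop) (S : ℝ → X →L[ℝ] X) : Prop where
  zero : S 0 = ContinuousLinearMap.id ℝ X
  add : ∀ s t, 0 ≤ s → 0 ≤ t → S (s + t) = (S s).comp (S t)
  cont : ∀ x, ContinuousOn (fun t => S t x) (Ici 0)
  generator : ∀ x y, Tendsto (fun h : ℝ => h⁻¹ • (S h x - x)) (𝓝[>] 0) (𝓝 y) ↔ G x y

/-- The norm `‖χ_ω f‖_{L¹(Ω; F)} = ∫_Ω χ_ω(x) |f(x)| dx`. -/
noncomputable def l1NormOn {d : ℕ} (Ω : Opens (EuclideanSpace ℝ (Fin d)))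
    {F : Type*} [NormedAddCommGroup F] (ω : Set (EuclideanSpace ℝ (Fin d)))
    (f : EuclideanSpace ℝ (Fin d) → F) : ℝ :=
  ∫ x in (Ω : Set (EuclideanSpace ℝ (Fin d))), ω.indicator (fun x => ‖f x‖) x

end CoupledHeat

/-! Fix a time `t` at which (a) and (c) hold, and split `S t z` at a frequency `μ`. On each
eigenfunction the semigroup is `e^{-aλt}` times a rotation of the plane of components, so the
coupling `b` does not affect norms and the modes above `μ` have size at most `e^{-aμt}‖z‖`
(`norm_semigroup_sub_truncation_le`). The modes below `μ` are controlled, one component at a time,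
by (c): the cost is `e^{D√μ/2}` times the `L¹` norm on `𝒟 t` of the truncation, and passing from the
truncation back to the full state adds the tail once more, measured in `L¹` of the bounded set `Ω`.
With `X` the observed norm this gives `‖S t z‖ ≤ K e^{D√μ/2} (X + e^{-aμt}‖z‖)` for every `μ` above
the first eigenvalue. Choose `μ` to balance the two terms. Since `√μ` grows more slowly than `μ`,
the loss `e^{D√μ/2}` is absorbed by `e^{θaμt}` up to the factor `e^{D²/(16aθt)}`
(`interpolation_of_frequency_bounds`). The semigroup is known only through its generator, so its
action on modes comes from uniqueness for the Cauchy problem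
(`IsSemigroupGeneratedBy.apply_eq_of_hasDerivAt`) and extends to all states by density. -/

namespace CoupledHeat

/-! ### Optimization over the cut-off frequency -/

/-- If `U ≤ K e^{D√μ/2} (X + e^{-aμt} Y)` at every frequency `μ > l` and `U ≤ e^{-alt} Y`, then
optimizing in `μ` gives a Hölder-type interpolation inequality. -/
lemma interpolation_of_frequency_bounds {a t D K θ X Y U l : ℝ} (ha : 0 < a) (ht : 0 < t)
    (hK : 1 ≤ K) (hθ : 0 < θ) (hθ1 : θ < 1) (hX : 0 < X) (hY : 0 < Y) (hU : 0 ≤ U) (hl : 0 ≤ l)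
    (hlow : U ≤ Real.exp (-(a * l * t)) * Y)
    (h : ∀ μ, l < μ → U ≤ K * Real.exp (D * √μ / 2) * (X + Real.exp (-(a * μ * t)) * Y)) :
    U ≤ 2 * K * Real.exp (D ^ 2 / (16 * a) * (1 / (θ * t))) * X ^ (1 - θ) * Y ^ θ := by
  have hX' : 0 < X ^ (1 - θ) := by positivity
  have hY' : 0 < Y ^ θ := by positivity
  have hexp : 1 ≤ Real.exp (D ^ 2 / (16 * a) * (1 / (θ * t))) := Real.one_le_exp (by positivity)
  -- This frequency balances the two terms: `e^{-aμt} Y = X`.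
  set μ := Real.log (Y / X) / (a * t) with hμ
  have hμe : Real.exp (a * μ * t) = Y / X := by
    have : a * μ * t = Real.log (Y / X) := by rw [hμ]; field_simp
    rw [this, Real.exp_log (by positivity)]
  rcases lt_or_ge l μ with hlt | hle
  · have hμ0 : 0 ≤ μ := hl.trans hlt.le
    have h1 := h μ hlt
    have h2 : Real.exp (-(a * μ * t)) * Y = X := by
      rw [Real.exp_neg, hμe]; field_simp
    -- Completing the square in `√μ`; this is the source of `D² / (16a)`.
    have h3 : D * √μ / 2 ≤ θ * (a * μ * t) + D ^ 2 / (16 * a) * (1 / (θ * t)) := by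
      have hs : √μ ^ 2 = μ := Real.sq_sqrt hμ0
      have : θ * (a * μ * t) + D ^ 2 / (16 * a) * (1 / (θ * t)) - D * √μ / 2
          = (4 * a * θ * t * √μ - D) ^ 2 / (16 * a * θ * t) := by
        field_simp
        linear_combination (-32 * θ ^ 2 * a ^ 2 * t ^ 2) * hs
      have : 0 ≤ (4 * a * θ * t * √μ - D) ^ 2 / (16 * a * θ * t) := by positivity
      linarith
    have h4 : Real.exp (θ * (a * μ * t)) = (Y / X) ^ θ := by
      rw [mul_comm, Real.exp_mul, hμe]
    have h5 : (Y / X) ^ θ * X = X ^ (1 - θ) * Y ^ θ := by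
      rw [Real.div_rpow hY.le hX.le, Real.rpow_sub hX, Real.rpow_one]; field_simp
    rw [h2] at h1
    calc U ≤ K * Real.exp (D * √μ / 2) * (X + X) := h1
      _ ≤ K * Real.exp (θ * (a * μ * t) + D ^ 2 / (16 * a) * (1 / (θ * t))) * (X + X) := by gcongr
      _ = 2 * K * Real.exp (D ^ 2 / (16 * a) * (1 / (θ * t))) * ((Y / X) ^ θ * X) := by
        rw [Real.exp_add, h4]; ring
      _ = _ := by rw [h5]; ring
  -- The balancing frequency is not above `l`, so `h` is unavailable there. The decay of the lowest
  -- mode alone then gives both `U ≤ X` and `U ≤ Y`, hence the bound by their geometric mean.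
  · have hUY : U ≤ Y := hlow.trans (mul_le_of_le_one_left hY.le (Real.exp_le_one_iff.2 (by
      have : 0 ≤ a * l * t := by positivity
      linarith)))
    have hUX : U ≤ X := by
      refine hlow.trans ?_
      have : Y / X ≤ Real.exp (a * l * t) := by rw [← hμe]; gcongr
      rw [Real.exp_neg, inv_mul_le_iff₀ (Real.exp_pos _)]
      rwa [div_le_iff₀ hX] at this
    have : U ≤ X ^ (1 - θ) * Y ^ θ := by
      calc U = U ^ (1 - θ + θ) := by simp
        _ = U ^ (1 - θ) * U ^ θ := Real.rpow_add_of_nonneg hU (by linarith) hθ.le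
        _ ≤ _ := by gcongr
    calc U ≤ 1 * (X ^ (1 - θ) * Y ^ θ) := by rwa [one_mul]
      _ ≤ 2 * K * Real.exp (D ^ 2 / (16 * a) * (1 / (θ * t))) * (X ^ (1 - θ) * Y ^ θ) := by
        gcongr; nlinarith
      _ = _ := by ring

/-- The interpolation inequality of `interpolation_of_frequency_bounds` for nonnegative data. -/
lemma interpolation_of_frequency_bounds_of_nonneg {a t D K θ X Y U l : ℝ} (ha : 0 < a)
    (ht : 0 < t) (hK : 1 ≤ K) (hθ : 0 < θ) (hθ1 : θ < 1) (hX : 0 ≤ X) (hY : 0 ≤ Y) (hU : 0 ≤ U)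
    (hl : 0 ≤ l) (hlow : U ≤ Real.exp (-(a * l * t)) * Y)
    (h : ∀ μ, l < μ → U ≤ K * Real.exp (D * √μ / 2) * (X + Real.exp (-(a * μ * t)) * Y)) :
    U ≤ 2 * K * Real.exp (D ^ 2 / (16 * a) * (1 / (θ * t))) * X ^ (1 - θ) * Y ^ θ := by
  rcases hY.eq_or_lt with rfl | hY
  · rw [mul_zero] at hlow
    exact hlow.trans (by positivity)
  -- The case `X = 0` has no balancing frequency. The hypothesis persists for every `x > X`, and the
  -- bound passes to the limit `x → X`.
  have hcont : Tendsto (fun x : ℝ =>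
      2 * K * Real.exp (D ^ 2 / (16 * a) * (1 / (θ * t))) * x ^ (1 - θ) * Y ^ θ) (𝓝[>] X)
      (𝓝 (2 * K * Real.exp (D ^ 2 / (16 * a) * (1 / (θ * t))) * X ^ (1 - θ) * Y ^ θ)) :=
    (((Real.continuousAt_rpow_const X (1 - θ) (Or.inr (by linarith))).tendsto.const_mul
      _).mul_const _).mono_left nhdsWithin_le_nhds
  refine ge_of_tendsto hcont (eventually_mem_nhdsWithin.mono fun x hx => ?_)
  have hx : X < x := hx
  refine interpolation_of_frequency_bounds ha ht hK hθ hθ1 (hX.trans_lt hx) hY hU hl hlow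
    fun μ hμ => (h μ hμ).trans ?_
  gcongr

/-! ### Strongly continuous semigroups and their Cauchy problem -/

section Semigroup

variable {X : Type*} [NormedAddCommGroup X] [NormedSpace ℝ X] [CompleteSpace X]
  {G : X → X → Prop} {S : ℝ → X →L[ℝ] X}

/-- Orbits are continuous, hence bounded on a compact time interval; the uniform boundedness
principle does the rest. -/
lemma IsSemigroupGeneratedBy.exists_norm_le (hS : IsSemigroupGeneratedBy G S) (t : ℝ) :
    ∃ C, ∀ s ∈ Icc 0 t, ‖S s‖ ≤ C := by
  have := banach_steinhaus (g := fun s : Icc (0 : ℝ) t => S s) fun x => by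
    obtain ⟨C, hC⟩ := (isCompact_Icc (a := (0 : ℝ)) (b := t)).exists_bound_of_continuousOn
      ((hS.cont x).mono Icc_subset_Ici_self)
    exact ⟨C, fun s => hC s s.2⟩
  obtain ⟨C, hC⟩ := this
  exact ⟨C, fun s hs => hC ⟨s, hs⟩⟩

/-- A strongly continuous semigroup propagates the solutions of the Cauchy problem of its
generator. -/
lemma IsSemigroupGeneratedBy.apply_eq_of_hasDerivAt (hS : IsSemigroupGeneratedBy G S)
    {w w' : ℝ → X} (hw : ∀ s, HasDerivAt w (w' s) s) (hG : ∀ s, G (w s) (w' s)) {t : ℝ}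
    (ht : 0 ≤ t) : S t (w 0) = w t := by
  obtain ⟨C, hC⟩ := hS.exists_norm_le t
  have hC0 : 0 ≤ C := (norm_nonneg _).trans (hC 0 ⟨le_rfl, ht⟩)
  -- The function `s ↦ S (t - s) (w s)` joins `S t (w 0)` to `w t`; it is constant because it is
  -- continuous with vanishing right derivative.
  have hcont : ContinuousOn (fun s => S (t - s) (w s)) (Icc 0 t) := by
    intro s hs
    have h1 : Tendsto (fun r => S (t - r) (w s)) (𝓝[Icc 0 t] s) (𝓝 (S (t - s) (w s))) := by
      refine (hS.cont (w s) (t - s) (by simpa using hs.2)).tendsto.comp ?_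
      refine tendsto_nhdsWithin_iff.2 ⟨?_, ?_⟩
      · exact ((continuous_const.sub continuous_id).tendsto s).mono_left nhdsWithin_le_nhds
      · filter_upwards [self_mem_nhdsWithin] with r hr
        simpa using hr.2
    have h2 : Tendsto (fun r => S (t - r) (w r - w s)) (𝓝[Icc 0 t] s) (𝓝 0) := by
      have h3 : Tendsto (fun r => C * ‖w r - w s‖) (𝓝[Icc 0 t] s) (𝓝 0) := by
        have : Tendsto (fun r => C * ‖w r - w s‖) (𝓝 s) (𝓝 (C * ‖w s - w s‖)) :=
          (((hw s).continuousAt.sub continuousAt_const).norm).const_mul C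
        simpa using this.mono_left nhdsWithin_le_nhds
      refine squeeze_zero_norm' ?_ h3
      filter_upwards [self_mem_nhdsWithin] with r hr
      exact ((S (t - r)).le_opNorm _).trans (by
        gcongr; exact hC _ ⟨by linarith [hr.2], by linarith [hr.1]⟩)
    have := h1.add h2
    simp only [add_zero] at this
    refine this.congr fun r => ?_
    rw [← map_add]; congr 1; abel
  have hderiv : ∀ s ∈ Ico 0 t,
      HasDerivWithinAt (fun s => S (t - s) (w s)) 0 (Ici s) s := by
    intro s hs
    refine HasDerivWithinAt.Ici_of_Ioi ?_
    rw [hasDerivWithinAt_iff_tendsto_slope' (by simp)]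
    have hshift : Tendsto (fun r => r - s) (𝓝[>] s) (𝓝[>] 0) := by
      refine tendsto_nhdsWithin_iff.2 ⟨?_, ?_⟩
      · have : Tendsto (fun r => r - s) (𝓝 s) (𝓝 (s - s)) :=
          (continuous_id.sub continuous_const).tendsto s
        simpa using this.mono_left nhdsWithin_le_nhds
      · filter_upwards [self_mem_nhdsWithin] with r hr
        simpa using hr
    have h1 : Tendsto (fun r => (r - s)⁻¹ • (S (r - s) (w s) - w s)) (𝓝[>] s) (𝓝 (w' s)) :=
      ((hS.generator _ _).2 (hG s)).comp hshift
    have h2 : Tendsto (slope w s) (𝓝[>] s) (𝓝 (w' s)) :=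
      (hasDerivWithinAt_iff_tendsto_slope' (by simp)).1 (hw s).hasDerivWithinAt
    have h3 : Tendsto (fun r => C * ‖slope w s r - (r - s)⁻¹ • (S (r - s) (w s) - w s)‖)
        (𝓝[>] s) (𝓝 0) := by
      simpa using (h2.sub h1).norm.const_mul C
    refine squeeze_zero_norm' ?_ h3
    filter_upwards [Ioo_mem_nhdsGT hs.2] with r hr
    -- Factoring out `S (t - r)` leaves the difference of two quotients, both tending to `w' s`; the
    -- right-sided definition of the generator suffices.
    have hrs : S (t - s) (w s) = S (t - r) (S (r - s) (w s)) := by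
      have : t - s = (t - r) + (r - s) := by ring
      rw [this, hS.add _ _ (by linarith [hr.2]) (by linarith [hr.1])]
      rfl
    have : slope (fun s => S (t - s) (w s)) s r =
        S (t - r) (slope w s r - (r - s)⁻¹ • (S (r - s) (w s) - w s)) := by
      simp only [slope_def_module, hrs, ← map_sub, ← map_smul]
      rw [← smul_sub]; congr 2; abel
    rw [this]
    exact ((S (t - r)).le_opNorm _).trans (by
      gcongr; exact hC _ ⟨by linarith [hr.2], by linarith [hr.1, hs.1]⟩)
  have := constant_of_has_deriv_right_zero hcont hderiv t ⟨ht, le_rfl⟩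
  simpa [hS.zero] using this.symm

/-- In the complex coordinate `p + iq` the generator is multiplication by `-(a + ib)l`, so the flow
is multiplication by `e^{-(a+ib)lt}`. -/
lemma IsSemigroupGeneratedBy.apply_eq_damped_rotation (hS : IsSemigroupGeneratedBy G S)
    {a b l : ℝ} {f g : X}
    (hG : ∀ p q : ℝ, G (p • f + q • g)
      ((-(a * l) * p + b * l * q) • f + (-(b * l) * p - a * l * q) • g))
    (x y : ℝ) {t : ℝ} (ht : 0 ≤ t) :
    S t (x • f + y • g) =
      (Real.exp (-(a * l * t)) * (Real.cos (b * l * t) * x + Real.sin (b * l * t) * y)) • f +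
      (Real.exp (-(a * l * t)) * (Real.cos (b * l * t) * y - Real.sin (b * l * t) * x)) • g := by
  let p : ℝ → ℝ := fun s =>
    Real.exp (-(a * l * s)) * (Real.cos (b * l * s) * x + Real.sin (b * l * s) * y)
  let q : ℝ → ℝ := fun s =>
    Real.exp (-(a * l * s)) * (Real.cos (b * l * s) * y - Real.sin (b * l * s) * x)
  have hlin : ∀ c s : ℝ, HasDerivAt (fun s => c * s) c s := fun c s => by
    simpa using (hasDerivAt_id s).const_mul c
  have hp : ∀ s, HasDerivAt p (-(a * l) * p s + b * l * q s) s := by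
    intro s
    refine HasDerivAt.congr_deriv (f := p) ((hlin (a * l) s).neg.exp.mul
      (((hlin (b * l) s).cos.mul_const x).add ((hlin (b * l) s).sin.mul_const y))) ?_
    simp [p, q]
    ring
  have hq : ∀ s, HasDerivAt q (-(b * l) * p s - a * l * q s) s := by
    intro s
    refine HasDerivAt.congr_deriv (f := q) ((hlin (a * l) s).neg.exp.mul
      (((hlin (b * l) s).cos.mul_const y).sub ((hlin (b * l) s).sin.mul_const x))) ?_
    simp [p, q]
    ring
  have := hS.apply_eq_of_hasDerivAt (w := fun s => p s • f + q s • g)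
    (fun s => ((hp s).smul_const f).add ((hq s).smul_const g)) (fun s => hG (p s) (q s)) ht
  simpa [p, q] using this

end Semigroup

/-! ### The Dirichlet Laplacian and the two components of a state -/

section DirichletLaplacian

section Integration

variable {α F : Type*} [MeasurableSpace α] {ν : Measure α} [NormedAddCommGroup F]

lemma tendsto_integral_inner_of_tendsto_eLpNorm [InnerProductSpace ℝ F] {h : ℕ → α → F} (g f : Lp F 2 ν)
    (hm : ∀ n, AEStronglyMeasurable (h n) ν)
    (hlim : Tendsto (fun n => eLpNorm (fun x => h n x - g x) 2 ν) atTop (𝓝 0)) :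
    Tendsto (fun n => ∫ x, inner ℝ (f x) (h n x) ∂ν) atTop (𝓝 (inner ℝ f g)) := by
  have hev : ∀ᶠ n in atTop, MemLp (fun x => h n x - g x) 2 ν := by
    filter_upwards [hlim.eventually (gt_mem_nhds ENNReal.zero_lt_top)] with n hn
    exact ⟨(hm n).sub (Lp.aestronglyMeasurable g), hn⟩
  rw [tendsto_iff_norm_sub_tendsto_zero]
  have hb : Tendsto (fun n => ‖f‖ * (eLpNorm (fun x => h n x - g x) 2 ν).toReal) atTop (𝓝 0) := by
    simpa using ((ENNReal.tendsto_toReal ENNReal.zero_ne_top).comp hlim).const_mul ‖f‖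
  refine squeeze_zero' (Eventually.of_forall fun n => norm_nonneg _) ?_ hb
  filter_upwards [hev] with n hn
  have hdiff : ∫ x, inner ℝ (f x) (h n x) ∂ν - inner ℝ f g = inner ℝ f (hn.toLp _) := by
    have hI : ∫ x, inner ℝ (f x) (h n x) ∂ν = inner ℝ f (hn.toLp _) + inner ℝ f g := by
      rw [L2.inner_def, L2.inner_def,
        ← integral_add (L2.integrable_inner _ _) (L2.integrable_inner _ _)]
      refine integral_congr_ae ?_
      filter_upwards [hn.coeFn_toLp] with x hx
      rw [hx, ← inner_add_right, sub_add_cancel]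
    rw [hI]; ring
  rw [hdiff, ← Lp.norm_toLp _ hn]
  exact norm_inner_le_norm _ _

/-- Cauchy–Schwarz against the constant `1`, whose norm is the square root of the total mass. -/
lemma integral_norm_le_norm_one_mul_norm [IsFiniteMeasure ν] (f : Lp F 2 ν) :
    ∫ x, ‖f x‖ ∂ν ≤ ‖(memLp_const (1 : ℝ) : MemLp (fun _ : α => (1 : ℝ)) 2 ν).toLp _‖ * ‖f‖ := by
  have hn : MemLp (fun x => ‖f x‖) 2 ν := (Lp.memLp f).norm
  have h1 : ∫ x, ‖f x‖ ∂ν =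
      inner ℝ ((memLp_const (1 : ℝ) : MemLp (fun _ : α => (1 : ℝ)) 2 ν).toLp _) (hn.toLp _) := by
    rw [L2.inner_def]
    refine integral_congr_ae ?_
    filter_upwards [hn.coeFn_toLp, (memLp_const (1 : ℝ) :
      MemLp (fun _ : α => (1 : ℝ)) 2 ν).coeFn_toLp] with x hx hx1
    rw [hx, hx1]; simp
  have h2 : ‖hn.toLp _‖ = ‖f‖ := by
    rw [Lp.norm_toLp, eLpNorm_norm, Lp.norm_def]
  rw [h1, ← h2]
  exact real_inner_le_norm _ _

end Integration

variable {d : ℕ} {Ω : Opens (EuclideanSpace ℝ (Fin d))}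

lemma continuous_gradient_testFunction (φ : 𝓓(Ω, ℝ)) : Continuous (gradient φ) := by
  have h : Continuous (fderiv ℝ φ) := φ.contDiff.continuous_fderiv (by simp)
  exact (InnerProductSpace.toDual ℝ (EuclideanSpace ℝ (Fin d))).symm.continuous.comp h

/-- Testing the weak equation with the approximants of `u` and passing to the limit gives `‖g‖² =
-⟨f, u⟩`. This is what makes the eigenvalues nonnegative. -/
lemma IsDirichletLaplacian.inner_nonpos {u f : L2 Ω ℝ} (h : IsDirichletLaplacian u f) :
    inner ℝ f u ≤ 0 := by
  obtain ⟨g, ⟨φ, hφ, hφ'⟩, hg⟩ := h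
  have h1 := tendsto_integral_inner_of_tendsto_eLpNorm g g
    (fun n => (continuous_gradient_testFunction (φ n)).aestronglyMeasurable) hφ'
  have h2 := tendsto_integral_inner_of_tendsto_eLpNorm u f
    (fun n => (φ n).continuous.aestronglyMeasurable) hφ
  have h3 := tendsto_nhds_unique (h1.congr fun n => hg (φ n)) (h2.neg.congr fun n => by
    congr 1; refine integral_congr_ae (Eventually.of_forall fun x => ?_)
    simp [mul_comm])
  have h4 : 0 ≤ inner ℝ g g := real_inner_self_nonneg
  linarith

lemma IsDirichletEigenbasis.nonneg {lam : ℕ → ℝ} {e : HilbertBasis ℕ ℝ (L2 Ω ℝ)}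
    (h : IsDirichletEigenbasis lam e) (i : ℕ) : 0 ≤ lam i := by
  have h1 := (h.eigen i).inner_nonpos
  rw [real_inner_smul_left, real_inner_self_eq_norm_sq, e.orthonormal.1 i] at h1
  linarith

lemma HasH10Gradient.smul {u : L2 Ω ℝ} {g : L2 Ω (EuclideanSpace ℝ (Fin d))}
    (h : HasH10Gradient u g) (c : ℝ) : HasH10Gradient (c • u) (c • g) := by
  obtain ⟨φ, h1, h2⟩ := h
  refine ⟨fun n => c • φ n, ?_, ?_⟩
  · have : Tendsto (fun n => ‖c‖ₑ * eLpNorm (fun x => φ n x - u x) 2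
        (volume.restrict (Ω : Set (EuclideanSpace ℝ (Fin d))))) atTop (𝓝 0) := by
      simpa using ENNReal.Tendsto.const_mul h1 (Or.inr enorm_ne_top)
    refine this.congr fun n => ?_
    rw [← eLpNorm_const_smul]
    refine eLpNorm_congr_ae ?_
    filter_upwards [Lp.coeFn_smul c u] with x hx
    simp [hx, mul_sub]
  · have : Tendsto (fun n => ‖c‖ₑ * eLpNorm (fun x => gradient (φ n) x - g x) 2
        (volume.restrict (Ω : Set (EuclideanSpace ℝ (Fin d))))) atTop (𝓝 0) := by
      simpa using ENNReal.Tendsto.const_mul h2 (Or.inr enorm_ne_top)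
    refine this.congr fun n => ?_
    rw [← eLpNorm_const_smul]
    refine eLpNorm_congr_ae ?_
    filter_upwards [Lp.coeFn_smul c g] with x hx
    have hd : gradient (c • φ n : 𝓓(Ω, ℝ)) x = c • gradient (φ n) x := by
      have : fderiv ℝ (c • φ n : 𝓓(Ω, ℝ)) x = c • fderiv ℝ (φ n) x :=
        fderiv_const_smul (((φ n).contDiff.differentiable (by simp)) x) c
      rw [gradient, this, map_smulₛₗ]
      rfl
    rw [hd, hx, Pi.smul_apply, Pi.smul_apply, smul_sub]

lemma IsDirichletLaplacian.smul {u f : L2 Ω ℝ} (h : IsDirichletLaplacian u f) (c : ℝ) :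
    IsDirichletLaplacian (c • u) (c • f) := by
  obtain ⟨g, h1, h2⟩ := h
  refine ⟨c • g, h1.smul c, fun φ => ?_⟩
  calc _ = ∫ x in (Ω : Set (EuclideanSpace ℝ (Fin d))), c * inner ℝ (g x) (gradient φ x) := by
        refine integral_congr_ae ?_
        filter_upwards [Lp.coeFn_smul c g] with x hx
        rw [hx, Pi.smul_apply, real_inner_smul_left]
    _ = -∫ x in (Ω : Set (EuclideanSpace ℝ (Fin d))), c * (f x * φ x) := by
        rw [integral_const_mul, h2, integral_const_mul]; ring
    _ = _ := by
        congr 1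
        refine integral_congr_ae ?_
        filter_upwards [Lp.coeFn_smul c f] with x hx
        simp [hx, mul_assoc]

/-- `component` as a continuous linear map. -/
noncomputable def componentCLM (k : Fin 2) : State Ω →L[ℝ] L2 Ω ℝ :=
  (EuclideanSpace.proj k : EuclideanSpace ℝ (Fin 2) →L[ℝ] ℝ).compLpL 2 _

/-- The embedding of `L²(Ω; ℝ)` into `L²(Ω; ℝ²)` as the `k`-th component. -/
noncomputable def embedding (k : Fin 2) : L2 Ω ℝ →L[ℝ] State Ω :=
  (ContinuousLinearMap.toSpanSingleton ℝ (EuclideanSpace.single k (1 : ℝ))).compLpL 2 _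

lemma componentCLM_apply (k : Fin 2) (z : State Ω) : componentCLM k z = component k z := rfl

lemma coeFn_component (k : Fin 2) (z : State Ω) :
    component k z =ᵐ[volume.restrict (Ω : Set (EuclideanSpace ℝ (Fin d)))] fun x => z x k :=
  ContinuousLinearMap.coeFn_compLp _ z

lemma coeFn_embedding (k : Fin 2) (u : L2 Ω ℝ) :
    embedding k u =ᵐ[volume.restrict (Ω : Set (EuclideanSpace ℝ (Fin d)))]
      fun x => u x • EuclideanSpace.single k (1 : ℝ) :=
  ContinuousLinearMap.coeFn_compLp _ u

lemma component_embedding (k l : Fin 2) (u : L2 Ω ℝ) :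
    component k (embedding l u) = if k = l then u else 0 := by
  refine Lp.ext ?_
  split_ifs with h
  · filter_upwards [coeFn_component k (embedding l u), coeFn_embedding l u] with x h1 h2
    rw [h1, h2, h]
    simp
  · filter_upwards [coeFn_component k (embedding l u), coeFn_embedding l u,
      Lp.coeFn_zero ℝ 2 (volume.restrict (Ω : Set (EuclideanSpace ℝ (Fin d))))] with x h1 h2 h3
    rw [h1, h2, h3]
    simp [h]

lemma embedding_component_add (z : State Ω) :
    embedding 0 (component 0 z) + embedding 1 (component 1 z) = z := by
  refine Lp.ext ?_
  filter_upwards [Lp.coeFn_add (embedding 0 (component 0 z)) (embedding 1 (component 1 z)),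
    coeFn_embedding 0 (component 0 z), coeFn_embedding 1 (component 1 z),
    coeFn_component 0 z, coeFn_component 1 z] with x h1 h2 h3 h4 h5
  rw [h1, Pi.add_apply, h2, h3, h4, h5]
  ext k
  fin_cases k <;> simp

lemma norm_sq_eq_component (z : State Ω) :
    ‖z‖ ^ 2 = ‖component 0 z‖ ^ 2 + ‖component 1 z‖ ^ 2 := by
  simp only [← real_inner_self_eq_norm_sq]
  rw [L2.inner_def, L2.inner_def, L2.inner_def,
    ← integral_add (L2.integrable_inner _ _) (L2.integrable_inner _ _)]
  refine integral_congr_ae ?_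
  filter_upwards [coeFn_component 0 z, coeFn_component 1 z] with x h1 h2
  rw [h1, h2]
  simp only [PiLp.inner_apply, Fin.sum_univ_two]

end DirichletLaplacian

/-! ### Modal expansion of the semigroup and decay of high frequencies -/

section SpectralDecomposition

section HilbertBasis

variable {H : Type*} [NormedAddCommGroup H] [InnerProductSpace ℝ H]

lemma hasSum_sq_inner (e : HilbertBasis ℕ ℝ H) (v : H) :
    HasSum (fun i => inner ℝ (e i) v ^ 2) (‖v‖ ^ 2) := by
  have := e.hasSum_inner_mul_inner v v
  rw [real_inner_self_eq_norm_sq] at this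
  refine this.congr_fun ?_
  intro i
  rw [real_inner_comm, sq]

/-- Two continuous functionals agreeing on a set with dense span are equal; this transfers formulas
on single modes to all states without summing series. -/
lemma eq_mul_inner_of_apply_basis (e : HilbertBasis ℕ ℝ H) (F : H →L[ℝ] ℝ) (i : ℕ) (c : ℝ)
    (hF : ∀ j, F (e j) = if i = j then c else 0) (u : H) : F u = c * inner ℝ (e i) u := by
  have : F = c • innerSL ℝ (e i) := by
    refine ContinuousLinearMap.ext_on
      (Submodule.dense_iff_topologicalClosure_eq_top.2 e.dense_span) ?_
    rintro _ ⟨j, rfl⟩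
    simp [hF, orthonormal_iff_ite.1 e.orthonormal]
  simp [this]

lemma inner_sum_range (e : HilbertBasis ℕ ℝ H) (c : ℕ → ℝ) (n i : ℕ) :
    inner ℝ (e i) (∑ j ∈ Finset.range n, c j • e j) = if i < n then c i else 0 := by
  simp [inner_sum, real_inner_smul_right, orthonormal_iff_ite.1 e.orthonormal]

lemma norm_sq_sum_range (e : HilbertBasis ℕ ℝ H) (c : ℕ → ℝ) (n : ℕ) :
    ‖∑ j ∈ Finset.range n, c j • e j‖ ^ 2 = ∑ i ∈ Finset.range n, |c i| ^ 2 := by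
  refine (hasSum_sq_inner e _).unique ?_
  simp only [inner_sum_range]
  have h : ∀ i ∉ Finset.range n, (if i < n then c i else 0) ^ 2 = 0 := fun i hi => by
    simp [show ¬ i < n by simpa using hi]
  have hsum : ∑ i ∈ Finset.range n, (if i < n then c i else 0) ^ 2 =
      ∑ i ∈ Finset.range n, |c i| ^ 2 :=
    Finset.sum_congr rfl fun i hi => by simp [Finset.mem_range.1 hi]
  exact hsum ▸ hasSum_sum_of_ne_finset_zero h

end HilbertBasis

lemma le_of_countUpTo_le {lam : ℕ → ℝ} (h : Tendsto lam atTop atTop) {μ : ℝ} {i : ℕ}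
    (hi : countUpTo lam μ ≤ i) : μ ≤ lam i := by
  by_contra! hlt
  obtain ⟨N, hN⟩ := eventually_atTop.1 (h.eventually_gt_atTop μ)
  -- The supremum of an unbounded set of naturals defaults to `0`, so boundedness, supplied by `lam
  -- → ∞`, is essential.
  have hbdd : BddAbove {k : ℕ | ∃ i, k = i + 1 ∧ lam i ≤ μ} := by
    refine ⟨N + 1, ?_⟩
    rintro _ ⟨j, rfl, hj⟩
    by_contra! hNj
    exact (hN j (by omega)).not_ge hj
  have : i + 1 ≤ countUpTo lam μ := le_csSup hbdd ⟨i, rfl, hlt.le⟩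
  omega

variable {d : ℕ} {Ω : Opens (EuclideanSpace ℝ (Fin d))} {lam : ℕ → ℝ}
  {e : HilbertBasis ℕ ℝ (L2 Ω ℝ)} {a b : ℝ} {S : ℝ → State Ω →L[ℝ] State Ω}

lemma component_smul_embedding_add (x y : ℝ) (u : L2 Ω ℝ) :
    component 0 (x • embedding 0 u + y • embedding 1 u) = x • u ∧
      component 1 (x • embedding 0 u + y • embedding 1 u) = y • u := by
  simp only [← componentCLM_apply, map_add, map_smul]
  simp [componentCLM_apply, component_embedding]

/-- The action of the semigroup on the span of a single eigenfunction: a damped rotation. -/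
lemma semigroup_apply_mode (he : IsDirichletEigenbasis lam e)
    (hS : IsSemigroupGeneratedBy (IsSystemOperator a b) S) {t : ℝ} (ht : 0 ≤ t) (i : ℕ)
    (x y : ℝ) :
    S t (x • embedding 0 (e i) + y • embedding 1 (e i)) =
      (Real.exp (-(a * lam i * t)) *
          (Real.cos (b * lam i * t) * x + Real.sin (b * lam i * t) * y)) • embedding 0 (e i) +
      (Real.exp (-(a * lam i * t)) *
          (Real.cos (b * lam i * t) * y - Real.sin (b * lam i * t) * x)) • embedding 1 (e i) := by
  refine hS.apply_eq_damped_rotation (fun p q => ?_) x y ht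
  refine ⟨p • (-(lam i) • e i), q • (-(lam i) • e i), ?_, ?_, ?_, ?_⟩
  · rw [(component_smul_embedding_add _ _ _).1]; exact (he.eigen i).smul _
  · rw [(component_smul_embedding_add _ _ _).2]; exact (he.eigen i).smul _
  · rw [(component_smul_embedding_add _ _ _).1]; module
  · rw [(component_smul_embedding_add _ _ _).2]; module

lemma inner_component_semigroup (he : IsDirichletEigenbasis lam e)
    (hS : IsSemigroupGeneratedBy (IsSystemOperator a b) S) {t : ℝ} (ht : 0 ≤ t) (i : ℕ)
    (z : State Ω) :
    inner ℝ (e i) (component 0 (S t z)) = Real.exp (-(a * lam i * t)) *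
        (Real.cos (b * lam i * t) * inner ℝ (e i) (component 0 z) +
          Real.sin (b * lam i * t) * inner ℝ (e i) (component 1 z)) ∧
      inner ℝ (e i) (component 1 (S t z)) = Real.exp (-(a * lam i * t)) *
        (Real.cos (b * lam i * t) * inner ℝ (e i) (component 1 z) -
          Real.sin (b * lam i * t) * inner ℝ (e i) (component 0 z)) := by
  have hort := orthonormal_iff_ite.1 e.orthonormal
  have h0 : ∀ j, embedding 0 (e j) =
      (1 : ℝ) • embedding 0 (e j) + (0 : ℝ) • embedding 1 (e j) := by simp
  have h1 : ∀ j, embedding 1 (e j) =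
      (0 : ℝ) • embedding 0 (e j) + (1 : ℝ) • embedding 1 (e j) := by simp
  have hz : S t z = S t (embedding 0 (component 0 z)) + S t (embedding 1 (component 1 z)) := by
    rw [← map_add, embedding_component_add]
  -- The `2 × 2` matrix of functionals giving mode `i` of component `m` of the output in terms of
  -- component `k` of the input.
  let F (m k : Fin 2) : L2 Ω ℝ →L[ℝ] ℝ :=
    (innerSL ℝ (e i)).comp ((componentCLM m).comp ((S t).comp (embedding k)))
  have hF : ∀ m, inner ℝ (e i) (component m (S t z)) =
      F m 0 (component 0 z) + F m 1 (component 1 z) := fun m => by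
    rw [hz, ← componentCLM_apply, map_add, inner_add_right]
    rfl
  have key : ∀ m k c, (∀ j, F m k (e j) = if i = j then c else 0) → ∀ u,
      F m k u = c * inner ℝ (e i) u := fun m k c h u => eq_mul_inner_of_apply_basis e _ i c h u
  have hval : ∀ m k j, F m k (e j) = inner ℝ (e i) (componentCLM m (S t (embedding k (e j)))) :=
    fun _ _ _ => rfl
  rw [hF, hF, key 0 0 (Real.exp (-(a * lam i * t)) * Real.cos (b * lam i * t)),
    key 0 1 (Real.exp (-(a * lam i * t)) * Real.sin (b * lam i * t)),
    key 1 0 (Real.exp (-(a * lam i * t)) * -Real.sin (b * lam i * t)),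
    key 1 1 (Real.exp (-(a * lam i * t)) * Real.cos (b * lam i * t))]
  · exact ⟨by ring, by ring⟩
  all_goals
    intro j
    rw [hval]
    first
      | rw [h0]
      | rw [h1]
    rw [semigroup_apply_mode he hS ht, componentCLM_apply]
    first
      | rw [(component_smul_embedding_add _ _ _).1]
      | rw [(component_smul_embedding_add _ _ _).2]
    rw [real_inner_smul_right, hort]
    by_cases hij : i = j
    · subst hij; simp
    · simp [hij]

/-- The rotation is isometric, so only the damping survives and `b` disappears from all later
estimates. -/
lemma sq_inner_component_semigroup (he : IsDirichletEigenbasis lam e)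
    (hS : IsSemigroupGeneratedBy (IsSystemOperator a b) S) {t : ℝ} (ht : 0 ≤ t) (i : ℕ)
    (z : State Ω) :
    inner ℝ (e i) (component 0 (S t z)) ^ 2 + inner ℝ (e i) (component 1 (S t z)) ^ 2 =
      Real.exp (-(a * lam i * t)) ^ 2 *
        (inner ℝ (e i) (component 0 z) ^ 2 + inner ℝ (e i) (component 1 z) ^ 2) := by
  obtain ⟨h0, h1⟩ := inner_component_semigroup he hS ht i z
  rw [h0, h1]
  linear_combination Real.exp (-(a * lam i * t)) ^ 2 *
    (inner ℝ (e i) (component 0 z) ^ 2 + inner ℝ (e i) (component 1 z) ^ 2) *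
      Real.sin_sq_add_cos_sq (b * lam i * t)

/-- The spectral truncation of a state to its first `n` modes. -/
noncomputable def truncation (e : HilbertBasis ℕ ℝ (L2 Ω ℝ)) (n : ℕ) (u : State Ω) : State Ω :=
  embedding 0 (∑ j ∈ Finset.range n, inner ℝ (e j) (component 0 u) • e j) +
    embedding 1 (∑ j ∈ Finset.range n, inner ℝ (e j) (component 1 u) • e j)

lemma component_truncation (e : HilbertBasis ℕ ℝ (L2 Ω ℝ)) (n : ℕ) (u : State Ω) (k : Fin 2) :
    component k (truncation e n u) =
      ∑ j ∈ Finset.range n, inner ℝ (e j) (component k u) • e j := by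
  rw [truncation, ← componentCLM_apply, map_add, componentCLM_apply, componentCLM_apply,
    component_embedding, component_embedding]
  fin_cases k <;> simp

lemma component_sub (k : Fin 2) (u v : State Ω) :
    component k (u - v) = component k u - component k v :=
  map_sub (componentCLM k) u v

/-- The modes with eigenvalue at least `μ` decay like `e^{-aμt}`. -/
lemma norm_semigroup_sub_truncation_le (he : IsDirichletEigenbasis lam e)
    (hS : IsSemigroupGeneratedBy (IsSystemOperator a b) S) (ha : 0 < a) {t : ℝ} (ht : 0 ≤ t)
    {n : ℕ} {μ : ℝ} (hμ : ∀ i, n ≤ i → μ ≤ lam i) (z : State Ω) :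
    ‖S t z - truncation e n (S t z)‖ ≤ Real.exp (-(a * μ * t)) * ‖z‖ := by
  refine le_of_sq_le_sq ?_ (by positivity)
  rw [mul_pow, norm_sq_eq_component, norm_sq_eq_component z]
  -- Parseval on both sides, compared mode by mode; the first `n` modes vanish on the left.
  refine hasSum_le (fun i => ?_) ((hasSum_sq_inner e _).add (hasSum_sq_inner e _))
    (((hasSum_sq_inner e _).add (hasSum_sq_inner e _)).mul_left _)
  simp only [component_sub, component_truncation, inner_sub_right, inner_sum_range]
  split_ifs with hi
  · simp only [sub_self, ne_eq, OfNat.ofNat_ne_zero, not_false_eq_true, zero_pow, add_zero]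
    positivity
  · rw [sub_zero, sub_zero, sq_inner_component_semigroup he hS ht]
    have := hμ i (not_lt.1 hi)
    gcongr

end SpectralDecomposition

/-! ### Stability of the observed `L¹` norm -/

section Observation

variable {d : ℕ} {Ω : Opens (EuclideanSpace ℝ (Fin d))}

lemma l1NormOn_nonneg {F : Type*} [NormedAddCommGroup F] (ω : Set (EuclideanSpace ℝ (Fin d)))
    (f : EuclideanSpace ℝ (Fin d) → F) : 0 ≤ l1NormOn Ω ω f :=
  integral_nonneg fun _ => indicator_nonneg (fun _ _ => norm_nonneg _) _

/-- Restricting one component to `ω` after an `L²`-perturbation. -/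
lemma l1NormOn_le_add [IsFiniteMeasure (volume.restrict (Ω : Set (EuclideanSpace ℝ (Fin d))))]
    {ω : Set (EuclideanSpace ℝ (Fin d))} (hω : NullMeasurableSet ω volume) (u : State Ω)
    (p : L2 Ω ℝ) (k : Fin 2) :
    l1NormOn Ω ω p ≤ l1NormOn Ω ω u +
      ∫ x in (Ω : Set (EuclideanSpace ℝ (Fin d))), ‖(component k u - p) x‖ := by
  have hω' : NullMeasurableSet ω (volume.restrict (Ω : Set (EuclideanSpace ℝ (Fin d)))) :=
    hω.mono_ac Measure.restrict_le_self.absolutelyContinuous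
  have hint : ∀ {F : Type} [NormedAddCommGroup F] (f : L2 Ω F),
      Integrable (fun x => ‖f x‖) (volume.restrict (Ω : Set (EuclideanSpace ℝ (Fin d)))) :=
    fun f => ((Lp.memLp f).integrable (by norm_num)).norm
  rw [l1NormOn, l1NormOn, ← integral_add ((hint u).indicator₀ hω') (hint _)]
  refine integral_mono_ae ((hint p).indicator₀ hω')
    (((hint u).indicator₀ hω').add (hint _)) ?_
  filter_upwards [coeFn_component k u, Lp.coeFn_sub (component k u) p] with x h1 h2
  rw [h2, Pi.sub_apply, h1]
  by_cases hx : x ∈ ω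
  · simp only [indicator_of_mem hx]
    have h3 : ‖u x k‖ ≤ ‖u x‖ := PiLp.norm_apply_le (u x) k
    have h4 := norm_sub_norm_le (p x) (u x k)
    rw [norm_sub_rev] at h4
    linarith
  · simp only [indicator_of_notMem hx]
    simp

end Observation

end CoupledHeat

/-! ### The interpolation inequality -/

theorem proposition3p7 {d : ℕ} (Ω : Opens (EuclideanSpace ℝ (Fin d)))
    (hΩ : Bornology.IsBounded (Ω : Set (EuclideanSpace ℝ (Fin d))))
    (a b : ℝ) (ha : 0 < a) (hb : b ≠ 0) (D : ℝ) (hD : 0 < D) :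
    ∃ M : ℝ, 0 < M ∧
      -- the Dirichlet eigenvalues and eigenfunctions, and the semigroup generated by `𝒜`
      ∀ (lam : ℕ → ℝ) (e : HilbertBasis ℕ ℝ (CoupledHeat.L2 Ω ℝ)),
      CoupledHeat.IsDirichletEigenbasis lam e →
      ∀ S : ℝ → CoupledHeat.State Ω →L[ℝ] CoupledHeat.State Ω,
      CoupledHeat.IsSemigroupGeneratedBy (CoupledHeat.IsSystemOperator a b) S →
      -- the time horizon, the set of times and the observation sets
      ∀ (T : ℝ), 0 < T →
      ∀ E : Set ℝ, E ⊆ Ioo 0 T → NullMeasurableSet E volume → 0 < volume E →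
      ∀ 𝒟 : ℝ → Set (EuclideanSpace ℝ (Fin d)),
      (∀ t ∈ Ioo 0 T, 𝒟 t ⊆ (Ω : Set (EuclideanSpace ℝ (Fin d)))) →
      -- assumption (a)
      (∀ᵐ t : ℝ, t ∈ Ioo 0 T → NullMeasurableSet (𝒟 t) volume) →
      -- assumption (b)
      (∀ f : EuclideanSpace ℝ (Fin d) × ℝ → ℝ,
        IntegrableOn f ((Ω : Set (EuclideanSpace ℝ (Fin d))) ×ˢ Ioo 0 T) volume →
        IntegrableOn (fun t => CoupledHeat.l1NormOn Ω (𝒟 t) (fun x => f (x, t)))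
          (Ioo 0 T) volume) →
      -- assumption (c)
      (∀ᵐ t : ℝ, t ∈ E → ∀ μ : ℝ, lam 0 < μ → ∀ c : ℕ → ℝ,
        ∑ i ∈ Finset.range (CoupledHeat.countUpTo lam μ), |c i| ^ 2 ≤
          D * Real.exp (D * √μ) *
            (CoupledHeat.l1NormOn Ω (𝒟 t)
              (∑ i ∈ Finset.range (CoupledHeat.countUpTo lam μ), c i • e i :
                CoupledHeat.L2 Ω ℝ)) ^ 2) →
      -- the interpolation inequality at a single time point
      ∀ θ : ℝ, 0 < θ → θ < 1 → ∀ᵐ t : ℝ, t ∈ E → ∀ z : CoupledHeat.State Ω,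
        ‖S t z‖ ≤
          M * Real.exp (M * (t / (1 - θ) + 1 / (θ * t))) *
            CoupledHeat.l1NormOn Ω (𝒟 t) (S t z) ^ (1 - θ) * ‖z‖ ^ θ := by
  have : IsFiniteMeasure (volume.restrict (Ω : Set (EuclideanSpace ℝ (Fin d)))) :=
    isFiniteMeasure_restrict.2 hΩ.measure_lt_top.ne
  set C : ℝ := ‖(memLp_const (1 : ℝ) : MemLp (fun _ => (1 : ℝ)) 2
    (volume.restrict (Ω : Set (EuclideanSpace ℝ (Fin d))))).toLp _‖ with hC
  have hC0 : 0 ≤ C := norm_nonneg _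
  -- `√(2D)` comes from applying (c) to both components, `1 + C` from the tail entering the
  -- observation, and the last `1` from the tail itself.
  set K : ℝ := √(2 * D) * (1 + C) + 1 with hK
  have hK1 : 1 ≤ K := by
    have : 0 ≤ √(2 * D) * (1 + C) := by positivity
    linarith
  refine ⟨2 * K + D ^ 2 / (16 * a), by positivity, ?_⟩
  intro lam e he S hS T hT E hE _ _ 𝒟 _ hmeas _ hobs θ hθ hθ1
  filter_upwards [hmeas, hobs] with t htm hto htE z
  obtain ⟨ht, htT⟩ := hE htE
  have hω := htm ⟨ht, htT⟩
  have hc := hto htE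
  set X := CoupledHeat.l1NormOn Ω (𝒟 t) (S t z) with hX
  have hX0 : 0 ≤ X := CoupledHeat.l1NormOn_nonneg _ _
  -- The truncation to no modes is zero, so the tail estimate becomes decay of the whole state at
  -- the first eigenvalue.
  have hlow : ‖S t z‖ ≤ Real.exp (-(a * lam 0 * t)) * ‖z‖ := by
    simpa [CoupledHeat.truncation] using
      CoupledHeat.norm_semigroup_sub_truncation_le he hS ha ht.le
        (n := 0) (fun i _ => he.mono (Nat.zero_le i)) z
  have hfreq : ∀ μ, lam 0 < μ →
      ‖S t z‖ ≤ K * Real.exp (D * √μ / 2) * (X + Real.exp (-(a * μ * t)) * ‖z‖) := by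
    intro μ hμ
    set n := CoupledHeat.countUpTo lam μ
    set u := S t z
    set P := CoupledHeat.truncation e n u
    set q := Real.exp (-(a * μ * t)) * ‖z‖ with hq
    have hq0 : 0 ≤ q := by positivity
    have htail : ‖u - P‖ ≤ q :=
      CoupledHeat.norm_semigroup_sub_truncation_le he hS ha ht.le
        (fun i hi => CoupledHeat.le_of_countUpTo_le he.tendsto hi) z
    have hcomp : ∀ k, ‖CoupledHeat.component k (u - P)‖ ≤ ‖u - P‖ := by
      intro k
      refine le_of_sq_le_sq ?_ (norm_nonneg _)
      rw [CoupledHeat.norm_sq_eq_component (u - P)]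
      fin_cases k
      · exact le_add_of_nonneg_right (sq_nonneg _)
      · exact le_add_of_nonneg_left (sq_nonneg _)
    have hpk : ∀ k, ‖CoupledHeat.component k P‖ ^ 2 ≤
        D * Real.exp (D * √μ) * (X + C * q) ^ 2 := by
      intro k
      have h1 : CoupledHeat.l1NormOn Ω (𝒟 t) (CoupledHeat.component k P) ≤ X + C * q := by
        refine (CoupledHeat.l1NormOn_le_add hω u _ k).trans ?_
        gcongr
        refine (CoupledHeat.integral_norm_le_norm_one_mul_norm _).trans ?_
        rw [← CoupledHeat.component_sub]
        gcongr
        exact (hcomp k).trans htail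
      -- The scalar inequality (c) is applied to the modal coefficients of the `k`-th component at
      -- time `t`.
      have h2 := hc μ hμ (fun i => inner ℝ (e i) (CoupledHeat.component k u))
      rw [← CoupledHeat.norm_sq_sum_range e, ← CoupledHeat.component_truncation] at h2
      refine h2.trans ?_
      have := CoupledHeat.l1NormOn_nonneg (Ω := Ω) (𝒟 t) (CoupledHeat.component k P)
      gcongr
    have hP : ‖P‖ ≤ √(2 * D) * Real.exp (D * √μ / 2) * (X + C * q) := by
      refine le_of_sq_le_sq ?_ (by positivity)
      have hexp : Real.exp (D * √μ / 2) ^ 2 = Real.exp (D * √μ) := by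
        rw [← Real.exp_nat_mul]; congr 1; push_cast; ring
      rw [mul_pow, mul_pow, Real.sq_sqrt (by positivity), hexp,
        CoupledHeat.norm_sq_eq_component]
      linarith [hpk 0, hpk 1]
    have hexp1 : 1 ≤ Real.exp (D * √μ / 2) := Real.one_le_exp (by positivity)
    calc ‖u‖ = ‖P + (u - P)‖ := by rw [add_sub_cancel]
      _ ≤ ‖P‖ + ‖u - P‖ := norm_add_le _ _
      _ ≤ √(2 * D) * Real.exp (D * √μ / 2) * (X + C * q) + 1 * q := by
        rw [one_mul]; exact add_le_add hP htail
      _ ≤ √(2 * D) * Real.exp (D * √μ / 2) * ((1 + C) * (X + q)) +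
          Real.exp (D * √μ / 2) * (X + q) := by
        gcongr
        · nlinarith [mul_nonneg hC0 hX0]
        · linarith
      _ = K * Real.exp (D * √μ / 2) * (X + q) := by rw [hK]; ring
  refine (CoupledHeat.interpolation_of_frequency_bounds_of_nonneg ha ht hK1 hθ hθ1 hX0
    (norm_nonneg z) (norm_nonneg _) (he.nonneg 0) hlow hfreq).trans ?_
  have h1θ : 0 < 1 - θ := by linarith
  have hDa : 0 ≤ D ^ 2 / (16 * a) := by positivity
  -- `M` dominates both the prefactor `2K` and the rate `D² / (16a)`; the nonnegative term `t / (1 -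
  -- θ)` only enlarges the bound.
  gcongr
  · exact le_add_of_nonneg_right hDa
  · linarith
  · exact le_add_of_nonneg_left (by positivity)
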